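/- For $|q|<1$ put $(q;q)_\infty=\prod_{k\ge1}(1-q^k)$ and $$A(q)=q^{1/5}(q;q)_\infty^{-3/5}\sum_{n\in\mathbb Z}(-1)^nq^{(5n^2-3n)/2},\qquad B(q)=(q;q)_\infty^{-3/5}\sum_{n\in\mathbb Z}(-1)^nq^{(5n^2-n)/2}.$$ Let $F(q)=q(q;q)_\infty^{24}=\sum_{m\ge0}\tau(m)q^m$, so that $\tau(0)=0$, and let $\Omega_{5,0}\bigl(\sum_m a_mq^m\bigr)=\sum_m a_{5m}q^m$. For each integer $n\ge0$ define rational numbers $a_{1,n},\dots,a_{5,n}$ by $$\begin{pmatrix}a_{1,n}\\a_{2,n}\\a_{3,n}\\a_{4,n}\\a_{5,n}\end{pmatrix}=\begin{pmatrix}893&-88&9&-1&1/5\\66352&-5702&506&-49&44/5\\1081476&-103301&9503&-887&722/5\\7778056&-740071&72578&-6992&5192/5\\19767160&-1881110&183530&-19520&2639\end{pmatrix}^{n}\begin{pmatrix}1\\44\\722\\5192\\13195\end{pmatrix}$$ and let $$P_n(u,v)=a_{1,n}u^8-a_{2,n}u^7v+a_{3,n}u^6v^2-a_{4,n}u^5v^3+a_{5,n}u^4v^4+a_{4,n}u^3v^5+a_{3,n}u^2v^6+a_{2,n}uv^7+a_{1,n}v^8.$$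 Then for every integer $n\ge0$: the polynomial $P_n$ has integer coefficients, and $P_n(x^5,y^5)$ is a nonzero homogeneous polynomial of degree $40$ in $x,y$; the $n$-th iterate of $\Omega_{5,0}$ satisfies $\Omega_{5,0}^{(n)}(F(q))=\sum_{m\ge0}\tau(5^nm)q^m$; for all $|q|<1$, with $x=B(q)$ and $y=A(q)$, $$\sum_{m=0}^\infty\tau(5^nm)q^m=5^nx^5y^5\,(x^{10}-11x^5y^5-y^{10})\,P_n(x^5,y^5);$$ and consequently $\tau(5^nm)\equiv0\pmod{5^n}$ for all integers $m\ge0$. -/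

import Mathlib

open scoped PowerSeries

/-- `(q;q)_∞ ^ s` for `‖q‖ < 1`, on the branch that equals `1` at `q = 0`. Every factor
`1 - q ^ k`, `k ≥ 1`, has positive real part, so that the principal logarithms are analytic. -/
noncomputable def eulerPower (q s : ℂ) : ℂ :=
  Complex.exp (s * ∑' k : ℕ, Complex.log (1 - q ^ (k + 1)))

/-- For natural exponents `eulerPower` is the power of the infinite product. -/
theorem eulerPower_natCast {q : ℂ} (hq : ‖q‖ < 1) (s : ℕ) :
    eulerPower q s = (∏' k : ℕ, (1 - q ^ (k + 1))) ^ s := by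
  have hlt : ∀ k : ℕ, ‖q ^ (k + 1)‖ < 1 := fun k => by
    rw [norm_pow]
    exact pow_lt_one₀ (norm_nonneg q) hq (Nat.succ_ne_zero k)
  have hsum : Summable fun k : ℕ => -q ^ (k + 1) := by
    refine Summable.neg ?_
    exact (summable_nat_add_iff 1).mpr (summable_geometric_of_norm_lt_one hq)
  have hlog : Summable fun k : ℕ => Complex.log (1 - q ^ (k + 1)) := by
    simpa [sub_eq_add_neg] using Complex.summable_log_one_add_of_summable hsum
  have hne : ∀ k : ℕ, (1 : ℂ) - q ^ (k + 1) ≠ 0 := fun k h => by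
    have h1 := hlt k
    rw [← sub_eq_zero.mp h] at h1
    simp at h1
  rw [eulerPower, Complex.exp_nat_mul, Complex.cexp_tsum_eq_tprod hne hlog]

/-- The quintic theta function
`A(q) = q^{1/5} (q;q)_∞^{-3/5} ∑_{n ∈ ℤ} (-1)^n q^{(5n²-3n)/2}`, with the principal value of
`q^{1/5}`. The exponents `(5n²-3n)/2` are nonnegative integers. -/
noncomputable def quinticA (q : ℂ) : ℂ :=
  q ^ (1 / 5 : ℂ) * eulerPower q (-3 / 5) *
    ∑' n : ℤ, (-1 : ℂ) ^ n * q ^ ((5 * n ^ 2 - 3 * n) / 2)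

/-- The quintic theta function
`B(q) = (q;q)_∞^{-3/5} ∑_{n ∈ ℤ} (-1)^n q^{(5n²-n)/2}`.
The exponents `(5n²-n)/2` are nonnegative integers. -/
noncomputable def quinticB (q : ℂ) : ℂ :=
  eulerPower q (-3 / 5) *
    ∑' n : ℤ, (-1 : ℂ) ^ n * q ^ ((5 * n ^ 2 - n) / 2)

open scoped PowerSeries.WithPiTopology in
/-- The `q`-series `F(q) = q (q;q)_∞^24` of the modular discriminant, as a formal power series. -/
noncomputable def discriminantSeries : ℤ⟦X⟧ :=
  PowerSeries.X * (∏' k : ℕ, (1 - PowerSeries.X ^ (k + 1) : ℤ⟦X⟧)) ^ 24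

/-- Ramanujan's tau function: `∑ τ(m) q^m = q (q;q)_∞^24`. -/
noncomputable def ramanujanTau (m : ℕ) : ℤ :=
  PowerSeries.coeff m discriminantSeries

/-- The multisection operator `Ω_{5,r} : ∑ a_k q^k ↦ ∑ a_{5k+r} q^k`. -/
noncomputable def quinticSection (r : ℕ) (f : ℤ⟦X⟧) : ℤ⟦X⟧ :=
  PowerSeries.mk fun k => PowerSeries.coeff (5 * k + r) f

/-- The generating matrix. -/
def tauMatrix : Matrix (Fin 5) (Fin 5) ℚ :=
  !![893, -88, 9, -1, 1 / 5;
     66352, -5702, 506, -49, 44 / 5;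
     1081476, -103301, 9503, -887, 722 / 5;
     7778056, -740071, 72578, -6992, 5192 / 5;
     19767160, -1881110, 183530, -19520, 2639]

/-- The coefficient vector `(a_{1,n}, …, a_{5,n})`, with indices shifted to `0, …, 4`. -/
def tauCoeff (n : ℕ) : Fin 5 → ℚ :=
  (tauMatrix ^ n).mulVec ![1, 44, 722, 5192, 13195]

/-- The polynomial `P_n(u, v)`, where `u = X 0` and `v = X 1`. -/
noncomputable def tauPoly (n : ℕ) : MvPolynomial (Fin 2) ℚ :=
  let a : Fin 5 → MvPolynomial (Fin 2) ℚ := fun i => MvPolynomial.C (tauCoeff n i)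
  let u : MvPolynomial (Fin 2) ℚ := MvPolynomial.X 0
  let v : MvPolynomial (Fin 2) ℚ := MvPolynomial.X 1
  a 0 * u ^ 8 - a 1 * u ^ 7 * v + a 2 * u ^ 6 * v ^ 2 - a 3 * u ^ 5 * v ^ 3
    + a 4 * u ^ 4 * v ^ 4
    + a 3 * u ^ 3 * v ^ 5 + a 2 * u ^ 2 * v ^ 6 + a 1 * u * v ^ 7 + a 0 * v ^ 8

/-! Write `f = (q;q)_∞`, `g = (q^5;q^5)_∞`, `u = B(q)^5`, `v = A(q)^5`, `D = u² - 11uv - v²` and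
`Δ(q) = q f^24`. Everything rests on `uv = q g^5 / f` and `D = f^5 / g` (`quintic_parametrization`),
whence `Δ(q) = uv D^5` and `Δ(q^5) = (uv)^5 D`.

The second ingredient is the Hecke relation `τ(5m) = 4830 τ(m) - 5^11 τ(m/5)`
(`ramanujanTau_five_mul`). Since `4830 = 5 · 966`, iterating it gives `τ(5^n m) = 5^n (α τ(m) + 5β
τ(m/5))` with integers `α`, `β` depending on `n` (`tauPair`). The generating function is therefore
`5^n uv D (α D^4 + 5β (uv)^4)`, and the last factor is `P_n`: the matrix preserves the span of the
coefficient vectors of `D^4` and `(uv)^4`, on which it acts as the recursion for `α`, `β`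
(`tauCoeff_eq`). Integrality and the congruence are then immediate, and `P_n ≠ 0` because `α ≡ 1`
mod 5.

Both ingredients come from the five-dissection of `(t;t)_∞` (`eulerProd_mul_eulerProd`), a
consequence of the Jacobi triple product at fifth roots of unity. Multiplying it over the rotations
`t ↦ η^j t` gives the formula for `D`; summing the 24th powers over the rotations gives the Hecke
relation. -/

open Filter Topology
open scoped PowerSeries

/-! ### The Jacobi triple product. -/

/-- The infinite product `(q;q)_∞`. -/
noncomputable def eulerProd (q : ℂ) : ℂ := ∏' k : ℕ, (1 - q ^ (k + 1))

/-- The finite product `(q;q)_n`. -/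
noncomputable def finiteEulerProd (q : ℂ) (n : ℕ) : ℂ := ∏ k ∈ Finset.range n, (1 - q ^ (k + 1))

/-- `1 / (q;q)_n` for an integer `n`, which is `0` for negative `n`. -/
noncomputable def invEulerProd (q : ℂ) (n : ℤ) : ℂ :=
  if 0 ≤ n then (finiteEulerProd q n.toNat)⁻¹ else 0

/-- The general term of the two-variable theta series. -/
noncomputable def thetaTerm (q z : ℂ) (n : ℤ) : ℂ := (-1) ^ n * q ^ (n * (n - 1) / 2) * z ^ n

theorem triangle_succ (n : ℤ) : (n + 1) * (n + 1 - 1) / 2 = n * (n - 1) / 2 + n := by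
  have : (n + 1) * (n + 1 - 1) = n * (n - 1) + n * 2 := by ring
  rw [this, Int.add_mul_ediv_right _ _ (by norm_num)]

theorem triangle_neg (n : ℤ) : -n * (-n - 1) / 2 = n * (n - 1) / 2 + n := by
  rw [← triangle_succ]; congr 1; ring

theorem one_sub_pow_ne_zero {q : ℂ} (hq : ‖q‖ < 1) (k : ℕ) : 1 - q ^ (k + 1) ≠ 0 := by
  intro h
  have h1 : ‖q ^ (k + 1)‖ < 1 := by
    rw [norm_pow]; exact pow_lt_one₀ (norm_nonneg q) hq (Nat.succ_ne_zero k)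
  rw [← sub_eq_zero.mp h] at h1
  simp at h1

theorem finiteEulerProd_ne_zero {q : ℂ} (hq : ‖q‖ < 1) (n : ℕ) : finiteEulerProd q n ≠ 0 :=
  Finset.prod_ne_zero_iff.mpr fun k _ => one_sub_pow_ne_zero hq k

theorem summable_norm_mul_pow (c : ℂ) {q : ℂ} (hq : ‖q‖ < 1) (k : ℕ) :
    Summable fun n : ℕ => ‖-(c * q ^ (n + k))‖ := by
  simp_rw [norm_neg, norm_mul, norm_pow]
  exact ((summable_nat_add_iff k).mpr
    (summable_geometric_of_lt_one (norm_nonneg _) hq)).mul_left _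

theorem multipliable_one_sub_mul_pow (c : ℂ) {q : ℂ} (hq : ‖q‖ < 1) (k : ℕ) :
    Multipliable fun n : ℕ => 1 - c * q ^ (n + k) := by
  simpa [sub_eq_add_neg] using multipliable_one_add_of_summable (summable_norm_mul_pow c hq k)

theorem hasProd_eulerProd {q : ℂ} (hq : ‖q‖ < 1) :
    HasProd (fun k : ℕ => 1 - q ^ (k + 1)) (eulerProd q) :=
  (ModularForm.multipliable_one_sub_pow hq).hasProd

theorem eulerProd_ne_zero {q : ℂ} (hq : ‖q‖ < 1) : eulerProd q ≠ 0 := by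
  have := tprod_one_add_ne_zero_of_summable (f := fun n : ℕ => -(1 * q ^ (n + 1)))
    (fun n => by simpa [sub_eq_add_neg] using one_sub_pow_ne_zero hq n)
    (summable_norm_mul_pow 1 hq 1)
  simpa [eulerProd, sub_eq_add_neg] using this

theorem tendsto_finiteEulerProd {q : ℂ} (hq : ‖q‖ < 1) :
    Tendsto (finiteEulerProd q) atTop (𝓝 (eulerProd q)) :=
  (hasProd_eulerProd hq).tendsto_prod_nat

theorem finiteEulerProd_succ (q : ℂ) (n : ℕ) :
    finiteEulerProd q (n + 1) = finiteEulerProd q n * (1 - q ^ (n + 1)) :=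
  Finset.prod_range_succ _ _

/-- The value `0` at negative integers makes this recursion hold on all of `ℤ`: at `n = 0` the
factor `1 - q^0` vanishes. No boundary terms then arise in the finite triple product. -/
theorem invEulerProd_sub_one {q : ℂ} (hq : ‖q‖ < 1) (n : ℤ) :
    invEulerProd q (n - 1) = (1 - q ^ n) * invEulerProd q n := by
  rcases lt_trichotomy n 0 with h | rfl | h
  · rw [invEulerProd, invEulerProd, if_neg (by omega), if_neg (by omega), mul_zero]
  · simp [invEulerProd]
  · obtain ⟨m, rfl⟩ : ∃ m : ℕ, n = m + 1 := ⟨(n - 1).toNat, by omega⟩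
    have h1 : ((m : ℤ) + 1).toNat = m + 1 := by omega
    have h2 : q ^ ((m : ℤ) + 1) = q ^ (m + 1) := by exact_mod_cast zpow_natCast q (m + 1)
    simp only [invEulerProd, add_sub_cancel_right, Int.natCast_nonneg, if_true, Int.toNat_natCast,
      show (0 : ℤ) ≤ m + 1 by omega, h1, h2, finiteEulerProd_succ]
    have := one_sub_pow_ne_zero hq m
    have := finiteEulerProd_ne_zero hq m
    field_simp

theorem exists_norm_invEulerProd_le {q : ℂ} (hq : ‖q‖ < 1) :
    ∃ C, ∀ n, ‖invEulerProd q n‖ ≤ C := by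
  obtain ⟨C, hC⟩ := ((tendsto_finiteEulerProd hq).inv₀ (eulerProd_ne_zero hq)).norm.bddAbove_range
  refine ⟨C, fun n => ?_⟩
  have h0 := hC ⟨0, rfl⟩
  rw [invEulerProd]
  split_ifs
  · exact hC ⟨_, rfl⟩
  · rw [norm_zero]; exact (norm_nonneg _).trans h0

theorem tendsto_invEulerProd {q : ℂ} (hq : ‖q‖ < 1) :
    Tendsto (invEulerProd q) atTop (𝓝 (eulerProd q)⁻¹) := by
  have h := (((tendsto_finiteEulerProd hq).inv₀ (eulerProd_ne_zero hq))).comp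
    (tendsto_atTop.mpr fun b => (eventually_ge_atTop (b : ℤ)).mono fun n hn => by omega :
      Tendsto Int.toNat atTop atTop)
  refine h.congr' ?_
  filter_upwards [eventually_ge_atTop 0] with n hn
  simp [invEulerProd, hn]

theorem summable_pow_triangle {r : ℝ} (h0 : 0 < r) (h1 : r < 1) {x : ℝ} (hx : 0 < x) :
    Summable fun n : ℕ => r ^ ((n : ℤ) * (n - 1) / 2) * x ^ (n : ℤ) := by
  refine summable_of_ratio_test_tendsto_lt_one (l := 0) one_pos
    (Eventually.of_forall fun n => by positivity) ?_
  have : Tendsto (fun n : ℕ => r ^ n * x) atTop (𝓝 0) := by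
    simpa using (tendsto_pow_atTop_nhds_zero_of_lt_one h0.le h1).mul_const x
  refine this.congr fun n => ?_
  push_cast
  rw [triangle_succ, zpow_add₀ h0.ne', zpow_add₀ hx.ne', zpow_one, Real.norm_of_nonneg,
    Real.norm_of_nonneg, zpow_natCast r n] <;> first | positivity | skip
  field_simp

theorem summable_norm_thetaTerm {q z : ℂ} (hq : ‖q‖ < 1) (hq0 : q ≠ 0) (hz : z ≠ 0) :
    Summable fun n => ‖thetaTerm q z n‖ := by
  have hr : 0 < ‖q‖ := norm_pos_iff.mpr hq0
  have hx : 0 < ‖z‖ := norm_pos_iff.mpr hz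
  have key : ∀ n : ℤ, ‖thetaTerm q z n‖ = ‖q‖ ^ (n * (n - 1) / 2) * ‖z‖ ^ n := fun n => by
    simp [thetaTerm]
  simp_rw [key]
  refine Summable.of_nat_of_neg (summable_pow_triangle hr hq hx) ?_
  -- The terms of negative index form the same series with `‖z‖` replaced by `‖q‖ / ‖z‖`.
  refine (summable_pow_triangle hr hq (div_pos hr hx)).congr fun n => ?_
  rw [triangle_neg, zpow_add₀ hr.ne', div_zpow, zpow_neg]
  field_simp

/-- The coefficients in the finite form of the Jacobi triple product. -/
noncomputable def finiteThetaTerm (q z : ℂ) (N : ℕ) (n : ℤ) : ℂ :=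
  finiteEulerProd q (2 * N) * invEulerProd q (N + n) * invEulerProd q (N - n) * thetaTerm q z n

theorem thetaTerm_add_one {q z : ℂ} (hq0 : q ≠ 0) (hz : z ≠ 0) (n : ℤ) :
    thetaTerm q z (n + 1) = -(q ^ n * z) * thetaTerm q z n := by
  rw [thetaTerm, thetaTerm, triangle_succ, zpow_add₀ hq0, zpow_add₀ hz,
    zpow_add₀ (by norm_num : (-1 : ℂ) ≠ 0)]
  simp
  ring

/-- This is multiplication of the finite product by `(1 - z q^N)(1 - z⁻¹ q^(N+1))`, read off at each
power of `z`; it plays the role of the q-Pascal rule. -/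
theorem finiteThetaTerm_succ {q z : ℂ} (hq : ‖q‖ < 1) (hq0 : q ≠ 0) (hz : z ≠ 0) (N : ℕ) (n : ℤ) :
    finiteThetaTerm q z (N + 1) n = (1 + q ^ (2 * N + 1)) * finiteThetaTerm q z N n
      - z * q ^ N * finiteThetaTerm q z N (n - 1)
      - z⁻¹ * q ^ (N + 1) * finiteThetaTerm q z N (n + 1) := by
  have e0 := thetaTerm_add_one hq0 hz n
  have e1 := thetaTerm_add_one hq0 hz (n - 1)
  rw [sub_add_cancel] at e1
  have a0 := invEulerProd_sub_one hq (N + 1 + n)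
  have a1 := invEulerProd_sub_one hq (N + n)
  have b0 := invEulerProd_sub_one hq (N + 1 - n)
  have b1 := invEulerProd_sub_one hq (N - n)
  have i1 : (N : ℤ) + 1 + n - 1 = N + n := by ring
  have i2 : (N : ℤ) + 1 - n - 1 = N - n := by ring
  rw [i1] at a0
  rw [i2] at b0
  have p1 : q ^ ((N : ℤ) + 1 + n) = q ^ N * q * q ^ n := by
    rw [zpow_add₀ hq0, zpow_add₀ hq0]; simp
  have p2 : q ^ ((N : ℤ) + 1 - n) = q ^ N * q / q ^ n := by
    rw [zpow_sub₀ hq0, zpow_add₀ hq0]; simp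
  have p3 : q ^ ((N : ℤ) + n) = q ^ N * q ^ n := by
    rw [zpow_add₀ hq0]; simp
  have p4 : q ^ ((N : ℤ) - n) = q ^ N / q ^ n := by
    rw [zpow_sub₀ hq0]; simp
  have p5 : q ^ (n - 1) = q ^ n / q := by rw [zpow_sub₀ hq0]; simp
  rw [p3, a0, p1] at a1
  rw [p4, b0, p2] at b1
  rw [p1] at a0
  rw [p2] at b0
  rw [p5] at e1
  have hT : thetaTerm q z (n - 1) = -(q / (q ^ n * z)) * thetaTerm q z n := by
    have : q ^ n ≠ 0 := zpow_ne_zero _ hq0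
    rw [e1]; field_simp
  have hd : 2 * (N + 1) = 2 * N + 1 + 1 := by ring
  have c1 : (N : ℤ) + (n - 1) = N + n - 1 := by ring
  have c2 : (N : ℤ) - (n - 1) = N + 1 - n := by ring
  have c3 : (N : ℤ) + (n + 1) = N + 1 + n := by ring
  have c4 : (N : ℤ) - (n + 1) = N - n - 1 := by ring
  simp only [finiteThetaTerm, hd, finiteEulerProd_succ, Nat.cast_add, Nat.cast_one, c1, c2, c3, c4,
    a0, a1, b0, b1, e0, hT]
  have hn : q ^ n ≠ 0 := zpow_ne_zero _ hq0
  generalize q ^ n = y at *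
  have hN : q ^ (2 * N + 1 + 1) = (q ^ N) ^ 2 * q ^ 2 := by ring
  have hN' : q ^ (2 * N + 1) = (q ^ N) ^ 2 * q := by ring
  have hN2 : q ^ (N + 1) = q ^ N * q := by ring
  rw [hN, hN', hN2]
  generalize q ^ N = x
  field_simp
  ring

/-- The finite form of the Jacobi triple product identity. -/
theorem hasSum_finiteThetaTerm {q z : ℂ} (hq : ‖q‖ < 1) (hq0 : q ≠ 0) (hz : z ≠ 0) (N : ℕ) :
    HasSum (finiteThetaTerm q z N)
      (∏ k ∈ Finset.range N, ((1 - z * q ^ k) * (1 - z⁻¹ * q ^ (k + 1)))) := by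
  induction N with
  | zero =>
    have : finiteThetaTerm q z 0 = Pi.single 0 1 := by
      funext n
      rcases lt_trichotomy n 0 with h | rfl | h
      · simp [finiteThetaTerm, invEulerProd, h.not_ge, h.ne]
      · simp [finiteThetaTerm, invEulerProd, finiteEulerProd, thetaTerm]
      · simp [finiteThetaTerm, invEulerProd, h.not_ge, h.ne']
    rw [this]
    simpa using hasSum_pi_single (0 : ℤ) (1 : ℂ)
  | succ N ih =>
    have hl := (Equiv.subRight (1 : ℤ)).hasSum_iff.mpr ih
    have hr := (Equiv.addRight (1 : ℤ)).hasSum_iff.mpr ih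
    have h := ((ih.mul_left (1 + q ^ (2 * N + 1))).sub (hl.mul_left (z * q ^ N))).sub
      (hr.mul_left (z⁻¹ * q ^ (N + 1)))
    have hzz : z * z⁻¹ = 1 := mul_inv_cancel₀ hz
    rw [Finset.prod_range_succ]
    generalize ∏ k ∈ Finset.range N, ((1 - z * q ^ k) * (1 - z⁻¹ * q ^ (k + 1))) = P at h ⊢
    have hv : P * ((1 - z * q ^ N) * (1 - z⁻¹ * q ^ (N + 1))) =
        (1 + q ^ (2 * N + 1)) * P - z * q ^ N * P - z⁻¹ * q ^ (N + 1) * P := by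
      linear_combination (P * q ^ (2 * N + 1)) * hzz
    rw [hv]
    rw [show finiteThetaTerm q z (N + 1) = _ from funext (finiteThetaTerm_succ hq hq0 hz N)]
    exact h

theorem tendsto_finiteThetaTerm {q z : ℂ} (hq : ‖q‖ < 1) (n : ℤ) :
    Tendsto (fun N => finiteThetaTerm q z N n) atTop
      (𝓝 ((eulerProd q)⁻¹ * thetaTerm q z n)) := by
  have h0 := eulerProd_ne_zero hq
  have hc := tendsto_natCast_atTop_atTop (R := ℤ)
  have h1 : Tendsto (fun N : ℕ => finiteEulerProd q (2 * N)) atTop (𝓝 (eulerProd q)) :=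
    (tendsto_finiteEulerProd hq).comp (tendsto_id.const_mul_atTop' two_pos)
  have h2 := (tendsto_invEulerProd hq).comp (tendsto_atTop_add_const_right _ n hc)
  have h3 := (tendsto_invEulerProd hq).comp (tendsto_atTop_add_const_right _ (-n) hc)
  have h := ((h1.mul h2).mul h3).mul_const (thetaTerm q z n)
  rw [mul_inv_cancel₀ h0, one_mul] at h
  exact h

/-- The **Jacobi triple product identity**. -/
theorem hasSum_thetaTerm {q z : ℂ} (hq : ‖q‖ < 1) (hq0 : q ≠ 0) (hz : z ≠ 0) :
    HasSum (thetaTerm q z) (eulerProd q * ((∏' k : ℕ, (1 - z * q ^ k)) *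
      ∏' k : ℕ, (1 - z⁻¹ * q ^ (k + 1)))) := by
  obtain ⟨C, hC⟩ := exists_norm_invEulerProd_le hq
  obtain ⟨D, hD⟩ := (tendsto_finiteEulerProd hq).norm.bddAbove_range
  have hsum := summable_norm_thetaTerm hq hq0 hz
  have hC0 : 0 ≤ C := (norm_nonneg _).trans (hC 0)
  -- Let `N → ∞` in the finite form: the quotients of finite products are bounded, so a multiple of
  -- the absolutely convergent theta series dominates.
  have lim := tendsto_tsum_of_dominated_convergence (𝓕 := atTop)
    (f := finiteThetaTerm q z) (g := fun n => (eulerProd q)⁻¹ * thetaTerm q z n)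
    (bound := fun n => D * C * C * ‖thetaTerm q z n‖) (hsum.mul_left _)
    (tendsto_finiteThetaTerm hq) (Eventually.of_forall fun N n => by
      rw [finiteThetaTerm, norm_mul, norm_mul, norm_mul]
      have h1 : ‖finiteEulerProd q (2 * N)‖ ≤ D := hD ⟨_, rfl⟩
      have h2 := hC (N + n)
      have h3 := hC (N - n)
      have hD0 : 0 ≤ D := (norm_nonneg _).trans h1
      gcongr)
  simp_rw [fun N => (hasSum_finiteThetaTerm hq hq0 hz N).tsum_eq] at lim
  have m1 := (multipliable_one_sub_mul_pow z hq 0).hasProd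
  have m2 := (multipliable_one_sub_mul_pow z⁻¹ hq 1).hasProd
  have h := tendsto_nhds_unique lim (m1.mul m2).tendsto_prod_nat
  simp only [add_zero] at h
  rw [← h, tsum_mul_left, mul_inv_cancel_left₀ (eulerProd_ne_zero hq)]
  exact hsum.of_norm.hasSum

/-! ### The quintic theta series and their product. -/

/-- The theta series `∑ (-1)^n q^((5n²-3n)/2)`. -/
noncomputable def quinticThetaA (q : ℂ) : ℂ :=
  ∑' n : ℤ, (-1 : ℂ) ^ n * q ^ ((5 * n ^ 2 - 3 * n) / 2)

/-- The theta series `∑ (-1)^n q^((5n²-n)/2)`. -/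
noncomputable def quinticThetaB (q : ℂ) : ℂ :=
  ∑' n : ℤ, (-1 : ℂ) ^ n * q ^ ((5 * n ^ 2 - n) / 2)

theorem two_mul_triangle (n : ℤ) : 2 * (n * (n - 1) / 2) = n * (n - 1) := by
  apply Int.mul_ediv_cancel'
  have := Int.even_mul_succ_self (n - 1)
  rw [sub_add_cancel, mul_comm] at this
  exact this.two_dvd

theorem thetaTerm_pow_pow {t : ℂ} (ht : t ≠ 0) (a b : ℕ) (n : ℤ) :
    thetaTerm (t ^ a) (t ^ b) n = (-1) ^ n * t ^ (a * (n * (n - 1) / 2) + b * n) := by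
  rw [thetaTerm, zpow_add₀ ht, zpow_mul, zpow_mul, zpow_natCast, zpow_natCast, mul_assoc]

theorem pow_five_lt_one {q : ℂ} (hq : ‖q‖ < 1) : ‖q ^ 5‖ < 1 := by
  rw [norm_pow]; exact pow_lt_one₀ (norm_nonneg q) hq (by norm_num)

theorem quinticThetaA_eq_tsum {q : ℂ} (hq0 : q ≠ 0) :
    quinticThetaA q = ∑' n, thetaTerm (q ^ 5) q n := by
  refine tsum_congr fun n => ?_
  have h := thetaTerm_pow_pow hq0 5 1 n
  rw [pow_one] at h
  rw [h]
  congr 2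
  have := two_mul_triangle n
  have h2 : 5 * n ^ 2 - 3 * n = 5 * (n * (n - 1)) + 2 * n := by ring
  push_cast
  rw [h2]
  omega

theorem quinticThetaB_eq_tsum {q : ℂ} (hq0 : q ≠ 0) :
    quinticThetaB q = ∑' n, thetaTerm (q ^ 5) (q ^ 2) n := by
  refine tsum_congr fun n => ?_
  rw [thetaTerm_pow_pow hq0 5 2 n]
  congr 2
  have := two_mul_triangle n
  have h2 : 5 * n ^ 2 - n = 5 * (n * (n - 1)) + 4 * n := by ring
  push_cast
  rw [h2]
  omega

theorem hasSum_quinticThetaA {q : ℂ} (hq : ‖q‖ < 1) (hq0 : q ≠ 0) :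
    HasSum (thetaTerm (q ^ 5) q) (quinticThetaA q) := by
  rw [quinticThetaA_eq_tsum hq0]
  exact (hasSum_thetaTerm (pow_five_lt_one hq) (pow_ne_zero 5 hq0) hq0).summable.hasSum

theorem hasSum_quinticThetaB {q : ℂ} (hq : ‖q‖ < 1) (hq0 : q ≠ 0) :
    HasSum (thetaTerm (q ^ 5) (q ^ 2)) (quinticThetaB q) := by
  rw [quinticThetaB_eq_tsum hq0]
  exact (hasSum_thetaTerm (pow_five_lt_one hq) (pow_ne_zero 5 hq0)
    (pow_ne_zero 2 hq0)).summable.hasSum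

/-- The product side has the factor `1 - q⁻¹ q = 0`. This removes one residue class from the
five-section below. -/
theorem hasSum_thetaTerm_self {q : ℂ} (hq : ‖q‖ < 1) (hq0 : q ≠ 0) :
    HasSum (thetaTerm q q) 0 := by
  have h := hasSum_thetaTerm hq hq0 hq0
  rw [tprod_of_exists_eq_zero (f := fun k : ℕ => 1 - q⁻¹ * q ^ (k + 1))
    ⟨0, by simp [hq0]⟩, mul_zero, mul_zero] at h
  exact h

theorem HasProd.prod_residues {g : ℕ → ℂ} {a : ℂ} (h : HasProd g a) (m : ℕ) [NeZero m] :
    HasProd (fun k => ∏ r : Fin m, g (k * m + r)) a := by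
  have h1 := (Nat.divModEquiv m).symm.hasProd_iff.mpr h
  exact h1.prod_fiberwise fun b => by
    simpa [Function.comp_def] using hasProd_fintype fun c : Fin m => g (b * m + c)

theorem HasSum.sum_residues_int {g : ℤ → ℂ} {a : ℂ} (h : HasSum g a) (m : ℕ) [NeZero m] :
    HasSum (fun k : ℤ => ∑ r : Fin m, g (k * m + (r : ℕ))) a := by
  have h1 := (Int.divModEquiv m).symm.hasSum_iff.mpr h
  exact h1.prod_fiberwise fun b => by
    simpa [Function.comp_def] using hasSum_fintype fun c : Fin m => g (b * m + (c : ℕ))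

theorem hasProd_one_sub_mul_pow (c : ℂ) {q : ℂ} (hq : ‖q‖ < 1) (k : ℕ) :
    HasProd (fun n : ℕ => 1 - c * q ^ (n + k)) (∏' n : ℕ, (1 - c * q ^ (n + k))) :=
  (multipliable_one_sub_mul_pow c hq k).hasProd

/-- By the triple product in base `q^5`, one series carries the exponents `±1` mod 5 and the other
`±2`, each with a factor `(q^5;q^5)_∞`; one of these supplies the exponents `0` mod 5. -/
theorem quinticThetaA_mul_quinticThetaB {q : ℂ} (hq : ‖q‖ < 1) (hq0 : q ≠ 0) :
    quinticThetaA q * quinticThetaB q = eulerProd q * eulerProd (q ^ 5) := by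
  have hq5 := pow_five_lt_one hq
  have hq50 := pow_ne_zero 5 hq0
  rw [(hasSum_quinticThetaA hq hq0).unique (hasSum_thetaTerm hq5 hq50 hq0),
    (hasSum_quinticThetaB hq hq0).unique (hasSum_thetaTerm hq5 hq50 (pow_ne_zero 2 hq0))]
  have h1 := hasProd_one_sub_mul_pow q hq5 0
  have h2 := hasProd_one_sub_mul_pow q⁻¹ hq5 1
  have h3 := hasProd_one_sub_mul_pow (q ^ 2) hq5 0
  have h4 := hasProd_one_sub_mul_pow (q ^ 2)⁻¹ hq5 1
  have hL := (((h1.mul h2).mul h3).mul h4).mul (hasProd_eulerProd hq5)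
  have hR := (hasProd_eulerProd hq).prod_residues 5
  have hfun : (fun k : ℕ => ∏ r : Fin 5, (1 - q ^ (k * 5 + (r : ℕ) + 1))) =
      fun k : ℕ => (1 - q * (q ^ 5) ^ (k + 0)) * (1 - q⁻¹ * (q ^ 5) ^ (k + 1)) *
        (1 - q ^ 2 * (q ^ 5) ^ (k + 0)) * (1 - (q ^ 2)⁻¹ * (q ^ 5) ^ (k + 1)) *
        (1 - (q ^ 5) ^ (k + 1)) := by
    funext k
    have e1 : q⁻¹ * (q ^ 5) ^ (k + 1) = q ^ (k * 5 + 4) := by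
      rw [← pow_mul]; field_simp; ring
    have e2 : (q ^ 2)⁻¹ * (q ^ 5) ^ (k + 1) = q ^ (k * 5 + 3) := by
      rw [← pow_mul]; field_simp; ring
    rw [e1, e2]
    simp only [Fin.prod_univ_five, Fin.isValue, Fin.val_zero, Fin.val_one, Fin.val_two, ← pow_mul,
      show ((3 : Fin 5) : ℕ) = 3 from rfl, show ((4 : Fin 5) : ℕ) = 4 from rfl]
    ring
  rw [hfun] at hR
  rw [← hL.unique hR]
  simp only [add_zero]
  ring

/-! ### Fifth roots of unity and the five-dissection. -/

theorem geom_sum_five_eq_zero {η : ℂ} (h5 : η ^ 5 = 1) (h1 : η ≠ 1) :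
    1 + η + η ^ 2 + η ^ 3 + η ^ 4 = 0 := by
  have : (η - 1) * (1 + η + η ^ 2 + η ^ 3 + η ^ 4) = 0 := by linear_combination h5
  exact (mul_eq_zero.mp this).resolve_left (sub_ne_zero.mpr h1)

theorem prod_sub_root_mul {η : ℂ} (h5 : η ^ 5 = 1) (h1 : η ≠ 1) (a b : ℂ) :
    (a - b) * (a - η * b) * (a - η ^ 2 * b) * (a - η ^ 3 * b) * (a - η ^ 4 * b) =
      a ^ 5 - b ^ 5 := by
  linear_combination (-a ^ 4 * b + a ^ 3 * b ^ 2 * (η + η ^ 3) - a ^ 2 * b ^ 3 * (η ^ 3 + η ^ 5)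
    + a * b ^ 4 * η ^ 6) * geom_sum_five_eq_zero h5 h1 - b ^ 5 * (η ^ 5 + 1) * h5

/-- The form splits as `(a - φx)(a - (1 - φ)x)` with `φ` the golden ratio, and each factor
multiplies to a difference of fifth powers. The 11 is `φ^5 + (1 - φ)^5`, while `φ^5 (1 - φ)^5 = -1`.
-/
theorem prod_quadratic_root_mul {η : ℂ} (h5 : η ^ 5 = 1) (h1 : η ≠ 1) (a b : ℂ) :
    (a ^ 2 - a * b - b ^ 2) * (a ^ 2 - a * (η * b) - (η * b) ^ 2) *
      (a ^ 2 - a * (η ^ 2 * b) - (η ^ 2 * b) ^ 2) * (a ^ 2 - a * (η ^ 3 * b) - (η ^ 3 * b) ^ 2) *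
      (a ^ 2 - a * (η ^ 4 * b) - (η ^ 4 * b) ^ 2) = a ^ 10 - 11 * a ^ 5 * b ^ 5 - b ^ 10 := by
  obtain ⟨φ, hφ⟩ : ∃ φ : ℂ, φ ^ 2 = φ + 1 := by
    refine ⟨(Real.goldenRatio : ℂ), ?_⟩
    exact_mod_cast congrArg (fun x : ℝ => (x : ℂ)) Real.goldenRatio_sq
  have hfac : ∀ x : ℂ, a ^ 2 - a * x - x ^ 2 = (a - φ * x) * (a - (1 - φ) * x) := fun x => by
    linear_combination (x ^ 2) * hφ
  have hp := prod_sub_root_mul h5 h1 a (φ * b)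
  have hm := prod_sub_root_mul h5 h1 a ((1 - φ) * b)
  have hφ5 : φ ^ 5 = 5 * φ + 3 := by
    linear_combination (φ ^ 3 + φ ^ 2 + 2 * φ + 3) * hφ
  have hφ5' : (1 - φ) ^ 5 = 8 - 5 * φ := by
    linear_combination (-φ ^ 3 + 4 * φ ^ 2 - 7 * φ + 7) * hφ
  simp only [hfac]
  calc _ = ((a - φ * b) * (a - η * (φ * b)) * (a - η ^ 2 * (φ * b)) * (a - η ^ 3 * (φ * b)) *
        (a - η ^ 4 * (φ * b))) * ((a - (1 - φ) * b) * (a - η * ((1 - φ) * b)) *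
        (a - η ^ 2 * ((1 - φ) * b)) * (a - η ^ 3 * ((1 - φ) * b)) *
        (a - η ^ 4 * ((1 - φ) * b))) := by ring
    _ = (a ^ 5 - (5 * φ + 3) * b ^ 5) * (a ^ 5 - (8 - 5 * φ) * b ^ 5) := by
      rw [hp, hm, mul_pow, mul_pow, hφ5, hφ5']
    _ = _ := by linear_combination (-25 * b ^ 10) * hφ

/-- The product of `(q;q)_∞` over the five rotations of `t`. -/
theorem prod_eulerProd_root_mul {η t : ℂ} (h5 : η ^ 5 = 1) (h1 : η ≠ 1) (ht : ‖t‖ < 1) :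
    eulerProd t * eulerProd (η * t) * eulerProd (η ^ 2 * t) * eulerProd (η ^ 3 * t) *
      eulerProd (η ^ 4 * t) * eulerProd ((t ^ 5) ^ 5) = eulerProd (t ^ 5) ^ 6 := by
  have hη : ‖η‖ = 1 := Complex.norm_eq_one_of_pow_eq_one h5 (by norm_num)
  have hn : ∀ j : ℕ, ‖η ^ j * t‖ < 1 := fun j => by simpa [hη] using ht
  have hη1 : ‖η * t‖ < 1 := by simpa [hη] using ht
  have hq := pow_five_lt_one ht
  have hL0 := ((((hasProd_eulerProd ht).mul (hasProd_eulerProd hη1)).mul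
    (hasProd_eulerProd (hn 2))).mul (hasProd_eulerProd (hn 3))).mul (hasProd_eulerProd (hn 4))
  have hL := (hL0.prod_residues 5).mul (hasProd_eulerProd (pow_five_lt_one hq))
  have hq1 := hasProd_eulerProd hq
  have hR := (hq1.prod_residues 5).mul ((((hq1.mul hq1).mul hq1).mul hq1).mul hq1)
  -- Exponents `n` prime to 5 contribute `1 - t^(5n)`; multiples of 5 are unaffected by the rotation
  -- and contribute a fifth power.
  have hrot : ∀ n : ℕ, η ^ n ≠ 1 → (1 - t ^ n) * (1 - (η * t) ^ n) * (1 - (η ^ 2 * t) ^ n) *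
      (1 - (η ^ 3 * t) ^ n) * (1 - (η ^ 4 * t) ^ n) = 1 - (t ^ 5) ^ n := fun n hn => by
    have h5n : (η ^ n) ^ 5 = 1 := by rw [← pow_mul, mul_comm, pow_mul, h5, one_pow]
    have := prod_sub_root_mul h5n hn 1 (t ^ n)
    rw [one_pow, pow_right_comm t n 5] at this
    rw [← this]
    ring
  have hfun : (fun k : ℕ => (∏ r : Fin 5, ((1 - t ^ (k * 5 + (r : ℕ) + 1)) *
        (1 - (η * t) ^ (k * 5 + (r : ℕ) + 1)) * (1 - (η ^ 2 * t) ^ (k * 5 + (r : ℕ) + 1)) *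
        (1 - (η ^ 3 * t) ^ (k * 5 + (r : ℕ) + 1)) * (1 - (η ^ 4 * t) ^ (k * 5 + (r : ℕ) + 1)))) *
        (1 - ((t ^ 5) ^ 5) ^ (k + 1))) =
      fun k : ℕ => (∏ r : Fin 5, (1 - (t ^ 5) ^ (k * 5 + (r : ℕ) + 1))) *
        ((1 - (t ^ 5) ^ (k + 1)) * (1 - (t ^ 5) ^ (k + 1)) * (1 - (t ^ 5) ^ (k + 1)) *
          (1 - (t ^ 5) ^ (k + 1)) * (1 - (t ^ 5) ^ (k + 1))) := by
    funext k
    have hmod : ∀ r : ℕ, η ^ (k * 5 + r + 1) = η ^ (r + 1) := fun r => by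
      rw [add_assoc, pow_add, mul_comm k 5, pow_mul, h5, one_pow, one_mul]
    have hpr : IsPrimitiveRoot η 5 := by
      have : Fact (Nat.Prime 5) := ⟨by norm_num⟩
      rw [← orderOf_eq_prime h5 h1]; exact IsPrimitiveRoot.orderOf η
    have hne : ∀ r : ℕ, r < 4 → η ^ (k * 5 + r + 1) ≠ 1 := fun r hr => by
      rw [hmod]; exact hpr.pow_ne_one_of_pos_of_lt (by omega) (by omega)
    have hlast : ∀ j : ℕ, (η ^ j * t) ^ (k * 5 + 4 + 1) = (t ^ 5) ^ (k + 1) := fun j => by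
      rw [mul_pow, show k * 5 + 4 + 1 = 5 * (k + 1) by ring, pow_mul (η ^ j), ← pow_mul η, mul_comm j,
        pow_mul η, h5, one_pow, one_pow, one_mul, pow_mul]
    have hl0 := hlast 0
    have hl1 := hlast 1
    rw [pow_zero, one_mul] at hl0
    rw [pow_one] at hl1
    have hx : (t ^ 5) ^ (k * 5 + 4 + 1) = ((t ^ 5) ^ 5) ^ (k + 1) := by
      rw [← pow_mul (t ^ 5)]; congr 1; ring
    simp only [Fin.prod_univ_five, Fin.isValue, Fin.val_zero, Fin.val_one, Fin.val_two,
      show ((3 : Fin 5) : ℕ) = 3 from rfl, show ((4 : Fin 5) : ℕ) = 4 from rfl]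
    rw [hrot _ (hne 0 (by norm_num)), hrot _ (hne 1 (by norm_num)), hrot _ (hne 2 (by norm_num)),
      hrot _ (hne 3 (by norm_num)), hl0, hl1, hlast 2, hlast 3, hlast 4, hx]
    ring
  rw [hfun] at hL
  rw [hL.unique hR]
  ring

theorem triangle_five_mul_add (m r : ℤ) :
    (m * 5 + r) * (m * 5 + r - 1) / 2 =
      25 * (m * (m - 1) / 2) + 10 * m + 5 * (m * r) + r * (r - 1) / 2 := by
  have h1 := two_mul_triangle (m * 5 + r)
  have h2 := two_mul_triangle m
  have h3 := two_mul_triangle r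
  linarith

/-- The five-section of the theta series at a fifth root of unity. -/
theorem hasSum_thetaTerm_root {η t : ℂ} (h5 : η ^ 5 = 1) (ht : ‖t‖ < 1) (ht0 : t ≠ 0) :
    HasSum (thetaTerm t η)
      ((1 - η) * quinticThetaB (t ^ 5) + (η ^ 2 - η ^ 4) * (t * quinticThetaA (t ^ 5))) := by
  have hη0 : η ≠ 0 := by rintro rfl; norm_num at h5
  have hq := pow_five_lt_one ht
  have hq0 := pow_ne_zero 5 ht0
  have hsum := (hasSum_thetaTerm ht ht0 hη0).summable.hasSum
  have hB := hasSum_quinticThetaB hq hq0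
  have hA := hasSum_quinticThetaA hq hq0
  have hC := hasSum_thetaTerm_self (pow_five_lt_one hq) (pow_ne_zero 5 hq0)
  have hB' := (Equiv.neg ℤ).hasSum_iff.mpr hB
  have hA' := (Equiv.neg ℤ).hasSum_iff.mpr hA
  have hA'' := (Equiv.addRight (1 : ℤ)).hasSum_iff.mpr hA
  -- The five terms are the classes of the index mod 5. Classes 0 and 1 give `B`, classes 2 and 4
  -- give `A`, after a reflection or shift of the index; class 3 sums to zero.
  have hR := (((hB.sub (hB'.mul_left η)).add (hA'.mul_left (η ^ 2 * t))).sub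
    (hC.mul_left (η ^ 3 * t ^ 3))).sub (hA''.mul_left (η ^ 4 * t))
  have hfun : (fun m : ℤ => ∑ r : Fin 5, thetaTerm t η (m * (5 : ℕ) + (r : ℕ))) = fun m : ℤ =>
      thetaTerm ((t ^ 5) ^ 5) ((t ^ 5) ^ 2) m
        - η * thetaTerm ((t ^ 5) ^ 5) ((t ^ 5) ^ 2) (-m)
        + η ^ 2 * t * thetaTerm ((t ^ 5) ^ 5) (t ^ 5) (-m)
        - η ^ 3 * t ^ 3 * thetaTerm ((t ^ 5) ^ 5) ((t ^ 5) ^ 5) m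
        - η ^ 4 * t * thetaTerm ((t ^ 5) ^ 5) (t ^ 5) (m + 1) := by
    funext m
    simp only [← pow_mul, thetaTerm_pow_pow ht0, triangle_neg, triangle_succ]
    have hterm : ∀ r : ℕ, thetaTerm t η (m * (5 : ℕ) + r) = (-1) ^ m * (-1) ^ r * η ^ r *
        t ^ (25 * (m * (m - 1) / 2) + 10 * m + 5 * (m * r) + (r : ℤ) * (r - 1) / 2) := fun r => by
      have e1 : (-1 : ℂ) ^ (m * ((5 : ℕ) : ℤ) + r) = (-1) ^ m * (-1) ^ r := by
        rw [zpow_add₀ (by norm_num), mul_comm m, zpow_mul, zpow_natCast, zpow_natCast]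
        norm_num
      have e2 : η ^ (m * ((5 : ℕ) : ℤ) + r) = η ^ r := by
        rw [zpow_add₀ hη0, mul_comm m, zpow_mul, zpow_natCast, zpow_natCast, h5, one_zpow, one_mul]
      rw [thetaTerm, e1, e2]
      push_cast
      rw [triangle_five_mul_add]
      ring
    have e0 : ((0 : ℕ) : ℤ) * ((0 : ℕ) - 1) / 2 = 0 := rfl
    have e1 : ((1 : ℕ) : ℤ) * ((1 : ℕ) - 1) / 2 = 0 := rfl
    have e2 : ((2 : ℕ) : ℤ) * ((2 : ℕ) - 1) / 2 = 1 := rfl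
    have e3 : ((3 : ℕ) : ℤ) * ((3 : ℕ) - 1) / 2 = 3 := rfl
    have e4 : ((4 : ℕ) : ℤ) * ((4 : ℕ) - 1) / 2 = 6 := rfl
    simp only [Fin.sum_univ_five, hterm, Fin.isValue, Fin.val_zero, Fin.val_one, Fin.val_two,
      show ((3 : Fin 5) : ℕ) = 3 from rfl, show ((4 : Fin 5) : ℕ) = 4 from rfl, e0, e1, e2, e3, e4]
    generalize m * (m - 1) / 2 = T
    push_cast
    simp only [mul_add, mul_neg, zpow_add₀ ht0, zpow_neg, zpow_add₀ (show (-1 : ℂ) ≠ 0 by norm_num),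
      zpow_mul, zpow_ofNat, mul_zero, mul_one]
    have hm : ((-1 : ℂ) ^ m)⁻¹ = (-1) ^ m := by
      rw [← inv_zpow]; norm_num
    rw [hm]
    have : t ^ m ≠ 0 := zpow_ne_zero _ ht0
    have hp : ∀ k : ℕ, (t ^ k) ^ m = (t ^ m) ^ k := fun k => by
      rw [← zpow_natCast, ← zpow_natCast, ← zpow_mul, ← zpow_mul, mul_comm]
    norm_num [hp]
    field_simp
    ring
  have hL := hsum.sum_residues_int 5
  rw [hfun] at hL
  have hv := hL.unique hR
  rw [hv] at hsum
  convert hsum using 1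
  ring

theorem exists_fifth_root_of_unity : ∃ η : ℂ, η ^ 5 = 1 ∧ η ≠ 1 := by
  have h := Complex.isPrimitiveRoot_exp 5 (by norm_num)
  exact ⟨_, h.pow_eq_one, h.ne_one (by norm_num)⟩

theorem tprod_one_sub_mul_pow_eq (c : ℂ) {q : ℂ} (hq : ‖q‖ < 1) :
    ∏' k : ℕ, (1 - c * q ^ k) = (1 - c) * ∏' k : ℕ, (1 - c * q ^ (k + 1)) := by
  have h := HasProd.zero_mul (f := fun k : ℕ => 1 - c * q ^ k) (hasProd_one_sub_mul_pow c hq 1)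
  have h2 := h.tprod_eq
  rw [pow_zero, mul_one] at h2
  exact h2

/-- The five-dissection of `(t;t)_∞`, in terms of the quintic theta series. -/
theorem eulerProd_mul_eulerProd {t : ℂ} (ht : ‖t‖ < 1) (ht0 : t ≠ 0) :
    eulerProd t * eulerProd (t ^ 5) = quinticThetaB (t ^ 5) ^ 2
      - quinticThetaB (t ^ 5) * (t * quinticThetaA (t ^ 5))
      - (t * quinticThetaA (t ^ 5)) ^ 2 := by
  obtain ⟨η, h5, h1⟩ := exists_fifth_root_of_unity
  have hη0 : η ≠ 0 := by rintro rfl; norm_num at h5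
  have h52 : (η ^ 2) ^ 5 = 1 := by rw [← pow_mul, mul_comm, pow_mul, h5, one_pow]
  have s1 := (hasSum_thetaTerm_root h5 ht ht0).unique (hasSum_thetaTerm ht ht0 hη0)
  have s2 := (hasSum_thetaTerm_root h52 ht ht0).unique
    (hasSum_thetaTerm ht ht0 (pow_ne_zero 2 hη0))
  have hsplit := fun c => tprod_one_sub_mul_pow_eq c ht
  rw [hsplit] at s1 s2
  have i1 : η⁻¹ = η ^ 4 := inv_eq_of_mul_eq_one_right (by linear_combination h5)
  have i2 : (η ^ 2)⁻¹ = η ^ 3 := inv_eq_of_mul_eq_one_right (by linear_combination h5)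
  rw [i1] at s1
  rw [i2] at s2
  have m1 := hasProd_one_sub_mul_pow η ht 1
  have m2 := hasProd_one_sub_mul_pow (η ^ 2) ht 1
  have m3 := hasProd_one_sub_mul_pow (η ^ 3) ht 1
  have m4 := hasProd_one_sub_mul_pow (η ^ 4) ht 1
  have hL := ((((hasProd_eulerProd ht).mul m1).mul m2).mul m3).mul m4
  have hfun : (fun k : ℕ => (1 - t ^ (k + 1)) * (1 - η * t ^ (k + 1)) * (1 - η ^ 2 * t ^ (k + 1)) *
      (1 - η ^ 3 * t ^ (k + 1)) * (1 - η ^ 4 * t ^ (k + 1))) =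
      fun k : ℕ => 1 - (t ^ 5) ^ (k + 1) := by
    funext k
    rw [pow_right_comm t 5, ← one_pow (M := ℂ) 5, ← prod_sub_root_mul h5 h1]
    norm_num
  rw [hfun] at hL
  have hP := hL.unique (hasProd_eulerProd (pow_five_lt_one ht))
  generalize (∏' k : ℕ, (1 - η * t ^ (k + 1))) = x1 at *
  generalize (∏' k : ℕ, (1 - η ^ 2 * t ^ (k + 1))) = x2 at *
  generalize (∏' k : ℕ, (1 - η ^ 3 * t ^ (k + 1))) = x3 at *
  generalize (∏' k : ℕ, (1 - η ^ 4 * t ^ (k + 1))) = x4 at *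
  generalize quinticThetaB (t ^ 5) = B at *
  generalize t * quinticThetaA (t ^ 5) = A at *
  have hne : (1 - η) * (1 - η ^ 2) ≠ 0 := by
    refine mul_ne_zero (sub_ne_zero.mpr h1.symm) (sub_ne_zero.mpr fun h => h1 ?_)
    rw [← h5, show η ^ 5 = (η ^ 2) ^ 2 * η by ring, ← h]; ring
  apply mul_left_cancel₀ hne
  -- The triple products at `η` and `η²` together involve all four nontrivial roots, so `hP`
  -- collapses them. After division by `(1 - η)(1 - η²)` the left factors are `B + (η² + η³)A` and
  -- `B + (η + η⁴)A`, whose coefficients of `A` have sum and product `-1`.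
  have hprod : ((1 - η) * B + (η ^ 2 - η ^ 4) * A) * ((1 - η ^ 2) * B + (η ^ 4 - η ^ 3) * A) =
      (1 - η) * (1 - η ^ 2) * (eulerProd t * eulerProd (t ^ 5)) := by
    have h8 : (η ^ 2) ^ 4 = η ^ 3 := by rw [← pow_mul]; linear_combination η ^ 3 * h5
    have h4 : (η ^ 2) ^ 2 = η ^ 4 := by ring
    rw [h8, h4] at s2
    rw [s1, s2, ← hP]
    ring
  rw [← hprod]
  linear_combination (-(A * B * (1 - η)) - A ^ 2 * (1 - η) * (1 - η ^ 2)) * h5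

/-- The 24th power is sorted by the exponent of `b` mod 5. Only the class of `b^4` survives the sum
over rotations, so the other four need no description; the Hecke constants 4830 and `5^11` appear in
this class. -/
theorem exists_quadratic_pow_section :
    ∃ E₀ E₁ E₂ E₃ : ℂ → ℂ → ℂ, ∀ a b c : ℂ, b ^ 5 = c → (a ^ 2 - a * b - b ^ 2) ^ 24 =
      E₀ a c + b * E₁ a c + b ^ 2 * E₂ a c + b ^ 3 * E₃ a c + b ^ 4 * (a ^ 4 *
        (4830 * (a ^ 10 - 11 * a ^ 5 * c - c ^ 2) ^ 4 - 5 ^ 11 * a ^ 20 * c ^ 4)) := by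
  refine ⟨fun a c => a ^ 48 - 6072 * a ^ 43 * c + 649704 * a ^ 38 * c ^ 2 - 7072408 * a ^ 33 * c ^ 3 + 6067446
      * a ^ 28 * c ^ 4 + 38228232 * a ^ 23 * c ^ 5 + 134596 * a ^ 18 * c ^ 6 - 2034672 * a ^ 13
      * c ^ 7 - 82731 * a ^ 8 * c ^ 8 + 1472 * a ^ 3 * c ^ 9,
    fun a c => - 24 * a ^ 47 - 16192 * a ^ 42 * c - 73416 * a ^ 37 * c ^ 2 - 3432198 * a ^ 32 * c ^ 3 +
      33474936 * a ^ 27 * c ^ 4 - 12286968 * a ^ 22 * c ^ 5 - 15343944 * a ^ 17 * c ^ 6 -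
      1977862 * a ^ 12 * c ^ 7 - 78936 * a ^ 7 * c ^ 8 + 252 * a ^ 2 * c ^ 9,
    fun a c => 252 * a ^ 46 + 78936 * a ^ 41 * c - 1977862 * a ^ 36 * c ^ 2 + 15343944 * a ^ 31 * c ^ 3 -
      12286968 * a ^ 26 * c ^ 4 - 33474936 * a ^ 21 * c ^ 5 - 3432198 * a ^ 16 * c ^ 6 + 73416 *
      a ^ 11 * c ^ 7 - 16192 * a ^ 6 * c ^ 8 + 24 * a * c ^ 9,
    fun a c => - 1472 * a ^ 45 - 82731 * a ^ 40 * c + 2034672 * a ^ 35 * c ^ 2 + 134596 * a ^ 30 * c ^ 3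
      - 38228232 * a ^ 25 * c ^ 4 + 6067446 * a ^ 20 * c ^ 5 + 7072408 * a ^ 15 * c ^ 6 + 649704
      * a ^ 10 * c ^ 7 + 6072 * a ^ 5 * c ^ 8 + c ^ 9, fun a b c hc => ?_⟩
  rw [← hc]
  ring

/-! ### Passage from the formal discriminant to the analytic one. -/

theorem hasSum_pentagonal_thetaTerm {q : ℂ} (hq : ‖q‖ < 1) (hq0 : q ≠ 0) :
    HasSum (thetaTerm (q ^ 3) q) (eulerProd q) := by
  have hq3 : ‖q ^ 3‖ < 1 := by
    rw [norm_pow]; exact pow_lt_one₀ (norm_nonneg q) hq (by norm_num)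
  have h := hasSum_thetaTerm hq3 (pow_ne_zero 3 hq0) hq0
  have h1 := hasProd_one_sub_mul_pow q hq3 0
  have h2 := hasProd_one_sub_mul_pow q⁻¹ hq3 1
  have hL := (hasProd_eulerProd hq3).mul (h1.mul h2)
  have hR := (hasProd_eulerProd hq).prod_residues 3
  have hfun : (fun k : ℕ => ∏ r : Fin 3, (1 - q ^ (k * 3 + (r : ℕ) + 1))) =
      fun k : ℕ => (1 - (q ^ 3) ^ (k + 1)) * ((1 - q * (q ^ 3) ^ (k + 0)) *
        (1 - q⁻¹ * (q ^ 3) ^ (k + 1))) := by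
    funext k
    have e1 : q⁻¹ * (q ^ 3) ^ (k + 1) = q ^ (k * 3 + 2) := by
      rw [← pow_mul]; field_simp; ring
    rw [e1]
    simp only [Fin.prod_univ_three, Fin.isValue, Fin.val_zero, Fin.val_one, Fin.val_two, ← pow_mul]
    ring
  rw [hfun] at hR
  have hv := hL.unique hR
  simp only [add_zero] at hv
  rw [hv] at h
  exact h

/-- Evaluation of an integral power series at a complex number. -/
def HasEvalSum (p : ℤ⟦X⟧) (q a : ℂ) : Prop :=
  HasSum (fun m : ℕ => ((PowerSeries.coeff m p : ℤ) : ℂ) * q ^ m) a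

theorem HasEvalSum.mul {p r : ℤ⟦X⟧} {q a b : ℂ} (hp : HasEvalSum p q a) (hr : HasEvalSum r q b) :
    HasEvalSum (p * r) q (a * b) := by
  have sp := hp.summable.norm
  have sr := hr.summable.norm
  have h1 := summable_norm_sum_mul_antidiagonal_of_summable_norm sp sr
  have h2 := tsum_mul_tsum_eq_tsum_sum_antidiagonal_of_summable_norm sp sr
  have h3 := h1.of_norm.hasSum
  rw [← h2, hp.tsum_eq, hr.tsum_eq] at h3
  rw [HasEvalSum]
  have e : (fun m : ℕ => ((PowerSeries.coeff m (p * r) : ℤ) : ℂ) * q ^ m) = fun n =>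
      ∑ kl ∈ Finset.HasAntidiagonal.antidiagonal n,
        ((PowerSeries.coeff kl.1 p : ℤ) : ℂ) * q ^ kl.1 *
        (((PowerSeries.coeff kl.2 r : ℤ) : ℂ) * q ^ kl.2) := by
    funext m
    rw [PowerSeries.coeff_mul, Int.cast_sum, Finset.sum_mul]
    refine Finset.sum_congr rfl fun kl hkl => ?_
    rw [← Finset.HasAntidiagonal.mem_antidiagonal.mp hkl, pow_add]
    push_cast
    ring
  rw [e]
  exact h3

theorem HasEvalSum.pow {p : ℤ⟦X⟧} {q a : ℂ} (hp : HasEvalSum p q a) (n : ℕ) :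
    HasEvalSum (p ^ n) q (a ^ n) := by
  induction n with
  | zero =>
    rw [pow_zero, pow_zero]
    have := hasSum_single (f := fun m : ℕ => ((PowerSeries.coeff m (1 : ℤ⟦X⟧) : ℤ) : ℂ) * q ^ m) 0
      (fun m hm => by simp [PowerSeries.coeff_one, hm])
    simpa [HasEvalSum] using this
  | succ n ih => rw [pow_succ, pow_succ]; exact ih.mul hp

theorem hasEvalSum_X (q : ℂ) : HasEvalSum PowerSeries.X q q := by
  have := hasSum_single (f := fun m : ℕ => ((PowerSeries.coeff m (PowerSeries.X : ℤ⟦X⟧) : ℤ) : ℂ) * q ^ m)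
      1 (fun m hm => by simp [PowerSeries.coeff_X, hm])
  simpa [HasEvalSum] using this

/-- The coefficients vanish off the pentagonal numbers, so the evaluation is a sum over `ℤ`, namely
the triple product in base `q^3`. The formal Euler product is thus tied to the analytic one. -/
theorem hasEvalSum_pentagonalSeries {q : ℂ} (hq : ‖q‖ < 1) (hq0 : q ≠ 0) :
    HasEvalSum (PowerSeries.pentagonalSeries ℤ) q (eulerProd q) := by
  rw [HasEvalSum, ← pentagonal_injective.hasSum_iff fun n hn => by
    rw [PowerSeries.coeff_pentagonalSeries_eq_zero ℤ hn]; simp]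
  have h := hasSum_pentagonal_thetaTerm hq hq0
  have hfun : ((fun m : ℕ => ((PowerSeries.coeff m (PowerSeries.pentagonalSeries ℤ) : ℤ) : ℂ) * q ^ m) ∘
      pentagonal) = thetaTerm (q ^ 3) q := by
    funext k
    have e := thetaTerm_pow_pow hq0 3 1 k
    rw [pow_one] at e
    have e2 : ((3 : ℕ) : ℤ) * (k * (k - 1) / 2) + ((1 : ℕ) : ℤ) * k = pentagonal k := by
      have h1 := two_mul_triangle k
      have h2 := two_mul_natCast_pentagonal k
      push_cast
      linarith
    rw [e, e2, zpow_natCast, Function.comp_apply, PowerSeries.coeff_pentagonalSeries_pentagonal,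
      Int.cast_id, Int.cast_negOnePow]
  rw [hfun]
  exact h

/-- The analytic `q`-expansion of the modular discriminant. -/
theorem hasSum_ramanujanTau {q : ℂ} (hq : ‖q‖ < 1) :
    HasSum (fun m : ℕ => (ramanujanTau m : ℂ) * q ^ m) (q * eulerProd q ^ 24) := by
  rcases eq_or_ne q 0 with rfl | hq0
  · rw [zero_mul]
    convert hasSum_zero using 2 with m
    rcases m with _ | m <;> simp [ramanujanTau, discriminantSeries]
  · have := (hasEvalSum_X q).mul ((hasEvalSum_pentagonalSeries hq hq0).pow 24)
    rw [← PowerSeries.WithPiTopology.tprod_one_sub_X_pow] at this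
    exact this

/-! ### The Hecke relation at the prime 5. -/

/-- The analytic modular discriminant as a function of `q`. -/
noncomputable def deltaFun (q : ℂ) : ℂ := q * eulerProd q ^ 24

theorem deltaFun_root_mul {η t : ℂ} (h5 : η ^ 5 = 1) (ht : ‖t‖ < 1) (ht0 : t ≠ 0) :
    deltaFun (η * t) * eulerProd (t ^ 5) ^ 24 = η * t * (quinticThetaB (t ^ 5) ^ 2
      - quinticThetaB (t ^ 5) * (η * (t * quinticThetaA (t ^ 5)))
      - (η * (t * quinticThetaA (t ^ 5))) ^ 2) ^ 24 := by
  have hη : ‖η‖ = 1 := Complex.norm_eq_one_of_pow_eq_one h5 (by norm_num)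
  have hη0 : η ≠ 0 := by rintro rfl; norm_num at h5
  have h := eulerProd_mul_eulerProd (t := η * t) (by simpa [hη] using ht) (mul_ne_zero hη0 ht0)
  rw [mul_pow η t 5, h5, one_mul, mul_assoc] at h
  rw [deltaFun, mul_assoc, ← mul_pow, h]

/-- The five-dissection is multiplied over the five rotations of `t`: the quadratic forms give the
degree-ten form and the Euler products give `prod_eulerProd_root_mul`. -/
theorem quintic_relation {t : ℂ} (ht : ‖t‖ < 1) (ht0 : t ≠ 0) :
    (quinticThetaB (t ^ 5) ^ 10 - 11 * quinticThetaB (t ^ 5) ^ 5 * (t * quinticThetaA (t ^ 5)) ^ 5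
      - (t * quinticThetaA (t ^ 5)) ^ 10) * eulerProd ((t ^ 5) ^ 5) = eulerProd (t ^ 5) ^ 11 := by
  obtain ⟨η, h5, h1⟩ := exists_fifth_root_of_unity
  have hη : ‖η‖ = 1 := Complex.norm_eq_one_of_pow_eq_one h5 (by norm_num)
  have hη0 : η ≠ 0 := by rintro rfl; norm_num at h5
  have key : ∀ j : ℕ, eulerProd (η ^ j * t) * eulerProd (t ^ 5) = quinticThetaB (t ^ 5) ^ 2
      - quinticThetaB (t ^ 5) * (η ^ j * (t * quinticThetaA (t ^ 5)))
      - (η ^ j * (t * quinticThetaA (t ^ 5))) ^ 2 := fun j => by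
    have h := eulerProd_mul_eulerProd (t := η ^ j * t) (by simpa [hη] using ht)
      (mul_ne_zero (pow_ne_zero j hη0) ht0)
    rwa [mul_pow (η ^ j) t 5, pow_right_comm, h5, one_pow, one_mul, mul_assoc] at h
  have k0 := eulerProd_mul_eulerProd ht ht0
  have k1 := key 1
  rw [pow_one] at k1
  rw [← prod_quadratic_root_mul h5 h1, ← k0, ← k1, ← key 2, ← key 3, ← key 4]
  linear_combination eulerProd (t ^ 5) ^ 5 * prod_eulerProd_root_mul h5 h1 ht

theorem sum_root_pow {η : ℂ} (h5 : η ^ 5 = 1) (h1 : η ≠ 1) (m : ℕ) :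
    1 + η ^ m + (η ^ 2) ^ m + (η ^ 3) ^ m + (η ^ 4) ^ m = if 5 ∣ m then 5 else 0 := by
  have h5m : (η ^ m) ^ 5 = 1 := by rw [pow_right_comm, h5, one_pow]
  rw [pow_right_comm η 2, pow_right_comm η 3, pow_right_comm η 4]
  split_ifs with h
  · obtain ⟨k, rfl⟩ := h
    rw [pow_mul, h5, one_pow]; norm_num
  · refine geom_sum_five_eq_zero h5m fun hm => h ?_
    have : Fact (Nat.Prime 5) := ⟨by norm_num⟩
    rw [← orderOf_eq_prime h5 h1]
    exact orderOf_dvd_of_pow_eq_one hm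

theorem HasSum.section_five {c : ℕ → ℂ} {F : ℂ → ℂ}
    (hF : ∀ q, ‖q‖ < 1 → HasSum (fun m => c m * q ^ m) (F q)) {η t : ℂ} (h5 : η ^ 5 = 1)
    (h1 : η ≠ 1) (ht : ‖t‖ < 1) :
    HasSum (fun m => 5 * (c (5 * m) * (t ^ 5) ^ m))
      (F t + F (η * t) + F (η ^ 2 * t) + F (η ^ 3 * t) + F (η ^ 4 * t)) := by
  have hη : ‖η‖ = 1 := Complex.norm_eq_one_of_pow_eq_one h5 (by norm_num)
  have hn : ∀ j : ℕ, ‖η ^ j * t‖ < 1 := fun j => by simpa [hη] using ht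
  have hη1 : ‖η * t‖ < 1 := by simpa [hη] using ht
  have h := ((((hF t ht).add (hF _ hη1)).add (hF _ (hn 2))).add (hF _ (hn 3))).add (hF _ (hn 4))
  have hfun : (fun m : ℕ => c m * t ^ m + c m * (η * t) ^ m + c m * (η ^ 2 * t) ^ m +
      c m * (η ^ 3 * t) ^ m + c m * (η ^ 4 * t) ^ m) =
      fun m => c m * t ^ m * if 5 ∣ m then 5 else 0 := by
    funext m
    rw [← sum_root_pow h5 h1 m]
    ring
  rw [hfun] at h
  have hinj : Function.Injective fun m : ℕ => 5 * m := mul_right_injective₀ (by norm_num)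
  rw [← hinj.hasSum_iff fun m hm => by
    rw [if_neg fun ⟨k, hk⟩ => hm ⟨k, hk.symm⟩, mul_zero]] at h
  convert h using 2 with m
  simp only [Function.comp_apply, dvd_mul_right, if_true, pow_mul]
  ring

theorem sum_deltaFun_root_mul {η t : ℂ} (h5 : η ^ 5 = 1) (h1 : η ≠ 1) (ht : ‖t‖ < 1)
    (ht0 : t ≠ 0) :
    deltaFun t + deltaFun (η * t) + deltaFun (η ^ 2 * t) + deltaFun (η ^ 3 * t) +
      deltaFun (η ^ 4 * t) = 5 * (4830 * deltaFun (t ^ 5) - 5 ^ 11 * deltaFun ((t ^ 5) ^ 5)) := by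
  obtain ⟨E₀, E₁, E₂, E₃, hE⟩ := exists_quadratic_pow_section
  have hq := pow_five_lt_one ht
  have hf := eulerProd_ne_zero hq
  have hf5 := eulerProd_ne_zero (pow_five_lt_one hq)
  have h5j : ∀ j : ℕ, (η ^ j) ^ 5 = 1 := fun j => by rw [pow_right_comm, h5, one_pow]
  have d0 := deltaFun_root_mul (one_pow 5) ht ht0
  have d1 := deltaFun_root_mul h5 ht ht0
  have d2 := deltaFun_root_mul (h5j 2) ht ht0
  have d3 := deltaFun_root_mul (h5j 3) ht ht0
  have d4 := deltaFun_root_mul (h5j 4) ht ht0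
  have hAB := quinticThetaA_mul_quinticThetaB hq (pow_ne_zero 5 ht0)
  have hrel := quintic_relation ht ht0
  rw [one_mul] at d0
  generalize hb : t * quinticThetaA (t ^ 5) = b at *
  generalize quinticThetaB (t ^ 5) = a at *
  have hroot : ∀ ξ : ℂ, ξ ^ 5 = 1 → (ξ * b) ^ 5 = b ^ 5 := fun ξ h => by rw [mul_pow, h, one_mul]
  rw [hE _ _ _ (hroot _ (one_pow 5))] at d0
  rw [hE _ _ _ (hroot _ h5)] at d1
  rw [hE _ _ _ (hroot _ (h5j 2))] at d2
  rw [hE _ _ _ (hroot _ (h5j 3))] at d3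
  rw [hE _ _ _ (hroot _ (h5j 4))] at d4
  apply mul_right_cancel₀ (pow_ne_zero 24 hf)
  have hab : a * b = t * (eulerProd (t ^ 5) * eulerProd ((t ^ 5) ^ 5)) := by
    rw [← hAB, ← hb]; ring
  have hrel' : a ^ 10 - 11 * a ^ 5 * b ^ 5 - (b ^ 5) ^ 2 =
      eulerProd (t ^ 5) ^ 11 / eulerProd ((t ^ 5) ^ 5) := by
    rw [eq_div_iff hf5, ← hrel]; ring
  have main : (deltaFun t + deltaFun (η * t) + deltaFun (η ^ 2 * t) + deltaFun (η ^ 3 * t) +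
      deltaFun (η ^ 4 * t)) * eulerProd (t ^ 5) ^ 24 = 5 * (t * (a * b) ^ 4 *
        (4830 * (a ^ 10 - 11 * a ^ 5 * b ^ 5 - (b ^ 5) ^ 2) ^ 4 - 5 ^ 11 * (a * b) ^ 20)) := by
    rw [add_mul, add_mul, add_mul, add_mul, d0, d1, d2, d3, d4]
    generalize E₀ a (b ^ 5) = e0
    generalize E₁ a (b ^ 5) = e1
    generalize E₂ a (b ^ 5) = e2
    generalize E₃ a (b ^ 5) = e3
    rw [show a ^ 4 * (4830 * (a ^ 10 - 11 * a ^ 5 * b ^ 5 - (b ^ 5) ^ 2) ^ 4 -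
      5 ^ 11 * a ^ 20 * (b ^ 5) ^ 4) = a ^ 4 * (4830 * (a ^ 10 - 11 * a ^ 5 * b ^ 5 -
        (b ^ 5) ^ 2) ^ 4 - 5 ^ 11 * (a * b) ^ 20) by ring]
    generalize 4830 * (a ^ 10 - 11 * a ^ 5 * b ^ 5 - (b ^ 5) ^ 2) ^ 4 - 5 ^ 11 * (a * b) ^ 20 = e4
    -- The factor `q` of the discriminant contributes one more root of unity, so the class of `b^j`
    -- is weighted by the sum of the powers `j + 1`, which vanishes unless `j = 4`.
    have s1 := sum_root_pow h5 h1 1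
    have s2 := sum_root_pow h5 h1 2
    have s3 := sum_root_pow h5 h1 3
    have s4 := sum_root_pow h5 h1 4
    have s5 := sum_root_pow h5 h1 5
    norm_num at s1 s2 s3 s4 s5
    linear_combination t * e0 * s1 + t * b * e1 * s2 + t * b ^ 2 * e2 * s3 + t * b ^ 3 * e3 * s4
      + t * b ^ 4 * a ^ 4 * e4 * s5
  rw [main, hab, hrel', deltaFun, deltaFun]
  generalize eulerProd ((t ^ 5) ^ 5) = g at *
  field_simp

/-- The coefficients of `F(q^5)`, where `F = ∑ τ(m) q^m`. -/
noncomputable def tauDiv (m : ℕ) : ℤ := if 5 ∣ m then ramanujanTau (m / 5) else 0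

theorem hasSum_deltaFun {q : ℂ} (hq : ‖q‖ < 1) :
    HasSum (fun m : ℕ => (ramanujanTau m : ℂ) * q ^ m) (deltaFun q) := hasSum_ramanujanTau hq

theorem hasSum_tauDiv {q : ℂ} (hq : ‖q‖ < 1) :
    HasSum (fun m : ℕ => (tauDiv m : ℂ) * q ^ m) (deltaFun (q ^ 5)) := by
  have hinj : Function.Injective fun m : ℕ => 5 * m := mul_right_injective₀ (by norm_num)
  rw [← hinj.hasSum_iff fun m hm => by
    rw [tauDiv, if_neg fun ⟨k, hk⟩ => hm ⟨k, hk.symm⟩, Int.cast_zero, zero_mul]]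
  have h := hasSum_deltaFun (pow_five_lt_one hq)
  have e : ((fun m : ℕ => (tauDiv m : ℂ) * q ^ m) ∘ fun m : ℕ => 5 * m) =
      fun m : ℕ => (ramanujanTau m : ℂ) * (q ^ 5) ^ m := by
    funext m
    simp [tauDiv, pow_mul]
  rw [e]
  exact h

theorem ramanujanTau_zero : ramanujanTau 0 = 0 := by
  simp [ramanujanTau, discriminantSeries]

theorem coeff_unique_of_hasSum {c d : ℕ → ℂ} {F : ℂ → ℂ}
    (hc : ∀ q, ‖q‖ < 1 → HasSum (fun m => c m * q ^ m) (F q))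
    (hd : ∀ q, ‖q‖ < 1 → HasSum (fun m => d m * q ^ m) (F q)) : c = d := by
  have key : ∀ c : ℕ → ℂ, (∀ q, ‖q‖ < 1 → HasSum (fun m => c m * q ^ m) (F q)) →
      HasFPowerSeriesAt F (FormalMultilinearSeries.ofScalars ℂ c) 0 := fun c hc => by
    rw [hasFPowerSeriesAt_iff]
    filter_upwards [Metric.ball_mem_nhds (0 : ℂ) one_pos] with z hz
    have := hc z (by simpa using hz)
    simpa [FormalMultilinearSeries.coeff_ofScalars, mul_comm] using this
  have h := (key c hc).eq_formalMultilinearSeries (key d hd)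
  funext n
  rw [← FormalMultilinearSeries.coeff_ofScalars (𝕜 := ℂ) (p := c), h,
    FormalMultilinearSeries.coeff_ofScalars]

theorem hasSum_ramanujanTau_five_mul {q : ℂ} (hq : ‖q‖ < 1) :
    HasSum (fun m : ℕ => (ramanujanTau (5 * m) : ℂ) * q ^ m)
      (4830 * deltaFun q - 5 ^ 11 * deltaFun (q ^ 5)) := by
  obtain ⟨t, rfl⟩ := IsAlgClosed.exists_pow_nat_eq q (n := 5) (by norm_num)
  rcases eq_or_ne t 0 with rfl | ht0
  · have e : 4830 * deltaFun (0 ^ 5) - 5 ^ 11 * deltaFun ((0 ^ 5) ^ 5) = 0 := by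
      simp [deltaFun]
    rw [e]
    convert hasSum_zero using 2 with m
    rcases m with _ | m <;> simp [ramanujanTau_zero]
  · have ht : ‖t‖ < 1 := by
      rw [norm_pow] at hq
      exact (pow_lt_one_iff_of_nonneg (norm_nonneg t) (by norm_num)).mp hq
    obtain ⟨η, h5, h1⟩ := exists_fifth_root_of_unity
    have h := HasSum.section_five (fun q hq => hasSum_deltaFun hq) h5 h1 ht
    rw [sum_deltaFun_root_mul h5 h1 ht ht0] at h
    exact (hasSum_mul_left_iff (by norm_num)).mp h

/-- The Hecke relation for the prime `5`. -/
theorem ramanujanTau_five_mul (m : ℕ) :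
    ramanujanTau (5 * m) = 4830 * ramanujanTau m - 5 ^ 11 * tauDiv m := by
  have h := coeff_unique_of_hasSum (c := fun m => (ramanujanTau (5 * m) : ℂ))
    (d := fun m => 4830 * (ramanujanTau m : ℂ) - 5 ^ 11 * (tauDiv m : ℂ))
    (fun q hq => hasSum_ramanujanTau_five_mul hq) (fun q hq => by
      have := ((hasSum_deltaFun hq).mul_left 4830).sub ((hasSum_tauDiv hq).mul_left (5 ^ 11))
      have e : (fun m : ℕ => (4830 * (ramanujanTau m : ℂ) - 5 ^ 11 * (tauDiv m : ℂ)) * q ^ m) =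
          fun m : ℕ => 4830 * ((ramanujanTau m : ℂ) * q ^ m) -
            5 ^ 11 * ((tauDiv m : ℂ) * q ^ m) := funext fun m => by ring
      rw [e]
      exact this)
  have := congrFun h m
  exact_mod_cast this

/-! ### Iteration of the Hecke relation and the polynomials `P_n`. -/

/-- Coordinates of the iterated sections of `F(q)` with respect to `F(q)` and `F(q^5)`. -/
def tauPair : ℕ → ℤ × ℤ
  | 0 => (1, 0)
  | n + 1 => (966 * (tauPair n).1 + (tauPair n).2, -5 ^ 9 * (tauPair n).1)

/-- Each step releases one factor 5: `4830 = 5 · 966`, `5^11 = 5 · 5 · 5^9`, and the explicit 5 in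
front of the second coordinate passes to `τ(m)` because `tauDiv (5 * m)` is `ramanujanTau m`. -/
theorem ramanujanTau_five_pow_mul (n m : ℕ) : ramanujanTau (5 ^ n * m) =
    5 ^ n * ((tauPair n).1 * ramanujanTau m + 5 * (tauPair n).2 * tauDiv m) := by
  induction n generalizing m with
  | zero => simp [tauPair]
  | succ n ih =>
    have hd : tauDiv (5 * m) = ramanujanTau m := by simp [tauDiv]
    rw [pow_succ, mul_assoc, ih, ramanujanTau_five_mul, hd, tauPair]
    ring

theorem tauPair_mod_five (n : ℕ) : (tauPair n).1 ≡ 1 [ZMOD 5] ∧ (5 : ℤ) ∣ (tauPair n).2 := by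
  induction n with
  | zero => exact ⟨rfl, dvd_zero _⟩
  | succ n ih =>
    obtain ⟨h1, h2⟩ := ih
    refine ⟨?_, ?_⟩ <;> simp only [tauPair, Int.ModEq] at * <;> omega

/-- The integral coefficient vector of `tauPoly n`. -/
def tauIntCoeff (n : ℕ) : Fin 5 → ℤ :=
  ![(tauPair n).1, 44 * (tauPair n).1, 722 * (tauPair n).1, 5192 * (tauPair n).1,
    13195 * (tauPair n).1 + 5 * (tauPair n).2]

/-- With `w` the initial vector and `e` the last basis vector, `tauMatrix` sends `w` to `966 w -
5^10 e` and `5e` to `w`, which is the recursion of `tauPair`. -/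
theorem tauCoeff_eq (n : ℕ) : tauCoeff n = fun i => (tauIntCoeff n i : ℚ) := by
  induction n with
  | zero =>
    funext i
    fin_cases i <;> simp [tauCoeff, tauIntCoeff, tauPair]
  | succ n ih =>
    have h : tauCoeff (n + 1) = tauMatrix.mulVec (tauCoeff n) := by
      rw [tauCoeff, tauCoeff, Matrix.mulVec_mulVec, pow_succ']
    rw [h, ih]
    funext i
    fin_cases i <;>
      simp [tauMatrix, tauIntCoeff, tauPair, Matrix.mulVec, dotProduct, Fin.sum_univ_five] <;> ring

/-- The numbers 1, 44, 722, 5192, 13195 are, up to sign, the coefficients of `(u² - 11uv - v²)^4`.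
-/
theorem aeval_tauPoly (n : ℕ) (u v : ℂ) : MvPolynomial.aeval ![u, v] (tauPoly n) =
    (tauPair n).1 * (u ^ 2 - 11 * u * v - v ^ 2) ^ 4 + 5 * (tauPair n).2 * (u * v) ^ 4 := by
  simp [tauPoly, tauCoeff_eq, tauIntCoeff]
  ring

theorem tauPoly_isHomogeneous_expand (n : ℕ) :
    (MvPolynomial.expand 5 (tauPoly n)).IsHomogeneous 40 := by
  have hX : ∀ i : Fin 2, (MvPolynomial.X i ^ 5 : MvPolynomial (Fin 2) ℚ).IsHomogeneous 5 :=
    fun i => by simpa using (MvPolynomial.isHomogeneous_X ℚ i).pow 5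
  have hterm : ∀ (c : ℚ) (i j : ℕ), i + j = 8 → (MvPolynomial.C c * (MvPolynomial.X 0 ^ 5) ^ i *
      (MvPolynomial.X 1 ^ 5) ^ j : MvPolynomial (Fin 2) ℚ).IsHomogeneous 40 := fun c i j hij => by
    have h := ((MvPolynomial.isHomogeneous_C (Fin 2) c).mul ((hX 0).pow i)).mul ((hX 1).pow j)
    rwa [show 0 + 5 * i + 5 * j = 40 by omega] at h
  have h0 := hterm (tauCoeff n 0) 8 0 rfl
  have h1 := hterm (tauCoeff n 1) 7 1 rfl
  have h2 := hterm (tauCoeff n 2) 6 2 rfl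
  have h3 := hterm (tauCoeff n 3) 5 3 rfl
  have h4 := hterm (tauCoeff n 4) 4 4 rfl
  have h5 := hterm (tauCoeff n 3) 3 5 rfl
  have h6 := hterm (tauCoeff n 2) 2 6 rfl
  have h7 := hterm (tauCoeff n 1) 1 7 rfl
  have h8 := hterm (tauCoeff n 0) 0 8 rfl
  have h := (((((((h0.sub h1).add h2).sub h3).add h4).add h5).add h6).add h7).add h8
  simpa [tauPoly] using h

theorem exists_map_eq_tauPoly (n : ℕ) :
    ∃ P : MvPolynomial (Fin 2) ℤ, MvPolynomial.map (Int.castRingHom ℚ) P = tauPoly n := by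
  let a : Fin 5 → MvPolynomial (Fin 2) ℤ := fun i => MvPolynomial.C (tauIntCoeff n i)
  let u : MvPolynomial (Fin 2) ℤ := MvPolynomial.X 0
  let v : MvPolynomial (Fin 2) ℤ := MvPolynomial.X 1
  refine ⟨a 0 * u ^ 8 - a 1 * u ^ 7 * v + a 2 * u ^ 6 * v ^ 2 - a 3 * u ^ 5 * v ^ 3
    + a 4 * u ^ 4 * v ^ 4
    + a 3 * u ^ 3 * v ^ 5 + a 2 * u ^ 2 * v ^ 6 + a 1 * u * v ^ 7 + a 0 * v ^ 8, ?_⟩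
  have hC : ∀ z : ℤ, MvPolynomial.map (Int.castRingHom ℚ) (MvPolynomial.C z) =
      (MvPolynomial.C (z : ℚ) : MvPolynomial (Fin 2) ℚ) := fun z => MvPolynomial.map_C _ _
  simp only [a, u, v, tauPoly, tauCoeff_eq, map_add, map_sub, map_mul, map_pow, MvPolynomial.map_X,
    hC]

theorem tauPoly_ne_zero (n : ℕ) : tauPoly n ≠ 0 := by
  intro h
  -- At `(1, 0)` only the first coordinate of `tauPair n` remains, and it is `1` mod 5.
  have h1 := aeval_tauPoly n 1 0
  rw [h, map_zero] at h1
  have h2 : (tauPair n).1 = 0 := by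
    have : ((tauPair n).1 : ℂ) = 0 := by linear_combination -h1
    exact_mod_cast this
  have h3 := (tauPair_mod_five n).1
  rw [h2] at h3
  exact absurd h3 (by decide)

/-! ### Parametrization of the discriminant by the quintic functions. -/

theorem eulerPower_pow_five {q : ℂ} (hq : ‖q‖ < 1) :
    eulerPower q (-3 / 5) ^ 5 = (eulerProd q ^ 3)⁻¹ := by
  have h := eulerPower_natCast hq 3
  rw [eulerProd, ← h, eulerPower, eulerPower, ← Complex.exp_nat_mul, ← Complex.exp_neg]
  congr 1
  push_cast
  ring

theorem quinticB_pow_five {q : ℂ} (hq : ‖q‖ < 1) :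
    quinticB q ^ 5 = quinticThetaB q ^ 5 / eulerProd q ^ 3 := by
  rw [quinticB, mul_pow, eulerPower_pow_five hq, quinticThetaB, div_eq_inv_mul]

theorem quinticA_pow_five {q : ℂ} (hq : ‖q‖ < 1) :
    quinticA q ^ 5 = q * quinticThetaA q ^ 5 / eulerProd q ^ 3 := by
  have h : (q ^ (1 / 5 : ℂ)) ^ 5 = q := by
    simp
  rw [quinticA, mul_pow, mul_pow, eulerPower_pow_five hq, quinticThetaA, h]
  ring

/-- Fifth powers remove the fractional exponents, so both formulas reduce to the theta product and
to `quintic_relation` at a fifth root of `q`. -/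
theorem quintic_parametrization {q : ℂ} (hq : ‖q‖ < 1) (hq0 : q ≠ 0) :
    quinticB q ^ 5 * quinticA q ^ 5 = q * eulerProd (q ^ 5) ^ 5 / eulerProd q ∧
    (quinticB q ^ 5) ^ 2 - 11 * quinticB q ^ 5 * quinticA q ^ 5 - (quinticA q ^ 5) ^ 2 =
      eulerProd q ^ 5 / eulerProd (q ^ 5) := by
  have hf := eulerProd_ne_zero hq
  have hf5 := eulerProd_ne_zero (pow_five_lt_one hq)
  have hAB := quinticThetaA_mul_quinticThetaB hq hq0
  have hrel : (quinticThetaB q ^ 10 - 11 * quinticThetaB q ^ 5 * (q * quinticThetaA q ^ 5)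
      - (q * quinticThetaA q ^ 5) ^ 2) * eulerProd (q ^ 5) = eulerProd q ^ 11 := by
    obtain ⟨t, rfl⟩ := IsAlgClosed.exists_pow_nat_eq q (n := 5) (by norm_num)
    have ht : ‖t‖ < 1 := by
      rw [norm_pow] at hq
      exact (pow_lt_one_iff_of_nonneg (norm_nonneg t) (by norm_num)).mp hq
    rw [← quintic_relation ht (by rintro rfl; simp at hq0)]
    ring
  rw [quinticB_pow_five hq, quinticA_pow_five hq]
  generalize eulerProd (q ^ 5) = g at *
  generalize eulerProd q = f at *
  generalize quinticThetaA q = a at *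
  generalize quinticThetaB q = b at *
  constructor
  · have : (a * b) ^ 5 = (f * g) ^ 5 := by rw [hAB]
    field_simp
    linear_combination this
  · field_simp
    linear_combination hrel

theorem hasSum_parametrization (n : ℕ) {q x y : ℂ} (hq : ‖q‖ < 1) (hx : x = quinticB q)
    (hy : y = quinticA q) :
    HasSum (fun m : ℕ => (ramanujanTau (5 ^ n * m) : ℂ) * q ^ m)
      (5 ^ n * x ^ 5 * y ^ 5 * (x ^ 10 - 11 * x ^ 5 * y ^ 5 - y ^ 10) *
        MvPolynomial.aeval ![x ^ 5, y ^ 5] (tauPoly n)) := by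
  have h := (((hasSum_deltaFun hq).mul_left ((tauPair n).1 : ℂ)).add
    ((hasSum_tauDiv hq).mul_left (5 * (tauPair n).2 : ℂ))).mul_left (5 ^ n)
  have e : (fun m : ℕ => (ramanujanTau (5 ^ n * m) : ℂ) * q ^ m) = fun m : ℕ =>
      5 ^ n * ((tauPair n).1 * ((ramanujanTau m : ℂ) * q ^ m) +
        5 * (tauPair n).2 * ((tauDiv m : ℂ) * q ^ m)) := by
    funext m
    rw [ramanujanTau_five_pow_mul]
    push_cast
    ring
  have hv : 5 ^ n * x ^ 5 * y ^ 5 * (x ^ 10 - 11 * x ^ 5 * y ^ 5 - y ^ 10) *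
      MvPolynomial.aeval ![x ^ 5, y ^ 5] (tauPoly n) =
      5 ^ n * ((tauPair n).1 * deltaFun q + 5 * (tauPair n).2 * deltaFun (q ^ 5)) := by
    rw [aeval_tauPoly]
    rcases eq_or_ne q 0 with rfl | hq0
    · have : y ^ 5 = 0 := by rw [hy, quinticA_pow_five hq]; simp
      simp [this, deltaFun]
    · obtain ⟨huv, hD⟩ := quintic_parametrization hq hq0
      have hf := eulerProd_ne_zero hq
      have hf5 := eulerProd_ne_zero (pow_five_lt_one hq)
      rw [← hx, ← hy] at huv hD
      -- With `uv = q g^5 / f` and `D = f^5 / g`, the powers of `g` cancel in `uv D^5`, and those of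
      -- `f` in `(uv)^5 D`.
      have d1 : deltaFun q = x ^ 5 * y ^ 5 *
          ((x ^ 5) ^ 2 - 11 * x ^ 5 * y ^ 5 - (y ^ 5) ^ 2) ^ 5 := by
        rw [huv, hD, deltaFun]; field_simp
      have d2 : deltaFun (q ^ 5) = (x ^ 5 * y ^ 5) ^ 5 *
          ((x ^ 5) ^ 2 - 11 * x ^ 5 * y ^ 5 - (y ^ 5) ^ 2) := by
        rw [huv, hD, deltaFun]; field_simp
      rw [d1, d2]
      ring
  rw [e, hv]
  exact h

theorem iterate_quinticSection (n : ℕ) : (quinticSection 0)^[n] discriminantSeries =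
    PowerSeries.mk (fun m => ramanujanTau (5 ^ n * m)) := by
  induction n with
  | zero => ext m; simp [ramanujanTau]
  | succ n ih =>
    rw [Function.iterate_succ_apply', ih]
    ext m
    simp [quinticSection, pow_succ, mul_assoc]

theorem theorem4p13 (n : ℕ) :
    -- `P_n` has integer coefficients
    (∃ P : MvPolynomial (Fin 2) ℤ, MvPolynomial.map (Int.castRingHom ℚ) P = tauPoly n) ∧
    -- `P_n(x^5, y^5)` is a nonzero homogeneous polynomial of degree 40 in `x, y`
    tauPoly n ≠ 0 ∧
    (MvPolynomial.expand 5 (tauPoly n)).IsHomogeneous 40 ∧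
    -- the `n`-th iterate of `Ω_{5,0}` applied to `F` is `∑ τ(5^n m) q^m`
    (quinticSection 0)^[n] discriminantSeries =
      PowerSeries.mk (fun m => ramanujanTau (5 ^ n * m)) ∧
    -- the parameterization, with `x = B(q)` and `y = A(q)`
    (∀ q x y : ℂ, ‖q‖ < 1 → x = quinticB q → y = quinticA q →
      HasSum (fun m : ℕ => (ramanujanTau (5 ^ n * m) : ℂ) * q ^ m)
        (5 ^ n * x ^ 5 * y ^ 5 * (x ^ 10 - 11 * x ^ 5 * y ^ 5 - y ^ 10) *
          MvPolynomial.aeval ![x ^ 5, y ^ 5] (tauPoly n))) ∧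
    -- the congruences
    (∀ m : ℕ, ramanujanTau (5 ^ n * m) ≡ 0 [ZMOD 5 ^ n]) := by
  refine ⟨exists_map_eq_tauPoly n, tauPoly_ne_zero n, tauPoly_isHomogeneous_expand n,
    iterate_quinticSection n, fun q x y hq hx hy => hasSum_parametrization n hq hx hy, fun m => ?_⟩
  rw [ramanujanTau_five_pow_mul]
  exact (Int.modEq_zero_iff_dvd).mpr (dvd_mul_right _ _)
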